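/- Let $\mathcal X_0$ and $\mathcal X$ be finite sets with $d_0=|\mathcal X_0|>1$, let $\mathbb K$ be a field, and let $\mathfrak R=\mathbb K[p_{ix} : i\in\mathcal X_0,\ x\in\mathcal X]$. For $i,j\in\mathcal X_0$ and $x,y\in\mathcal X$ put $f^{ij}_{xy}=p_{ix}p_{jy}-p_{iy}p_{jx}$. Let $G$ be a simple graph with vertex set $\mathcal X$, and let $I_G\subseteq\mathfrak R$ be the ideal generated by all $f^{ij}_{xy}$ with $i,j\in\mathcal X_0$ and $(x,y)$ an edge of $G$. For $\mathcal Y\subseteq\mathcal X$ let $G_{\mathcal Y}$ be the subgraph of $G$ induced by $\mathcal Y$, and let $I_{G,\mathcal Y}\subseteq\mathfrak R$ be the ideal generated by the variables $p_{ix}$ with $i\in\mathcal X_0$, $x\in\mathcal X\setminus\mathcal Y$, and by the binomials $f^{ij}_{xy}$ with $i,j\in\mathcal X_0$ and $x,y\in\mathcal Y$ in the same connected component of $G_{\mathcal Y}$. Let $\mathcal D(G)$ be the collection of all $\mathcal Y\subseteq\mathcal X$ such that for every $x\in\mathcal X\setminus\mathcal Y$ the graph $G_{\mathcal Y\cup\{x\}}$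 has strictly fewer connected components than $G_{\mathcal Y}$. Then: 1. A set $\mathcal Y\subseteq\mathcal X$ belongs to $\mathcal D(G)$ if and only if for every $x\in\mathcal X\setminus\mathcal Y$ there are edges $(x,y),(x,z)$ of $G$ such that $y,z\in\mathcal Y$ are not connected in $G_{\mathcal Y}$. 2. $I_G=\bigcap_{\mathcal Y\in\mathcal D(G)} I_{G,\mathcal Y}$. 3. For every $\mathcal Y\subseteq\mathcal X$ the ideal $I_{G,\mathcal Y}$ is prime, and the affine variety $\operatorname{Spec}(\mathfrak R/I_{G,\mathcal Y})$ is rational over $\mathbb K$, i.e. birational over $\mathbb K$ to an affine space. 4. The intersection in 2 is the minimal primary decomposition of $I_G$: the ideals $I_{G,\mathcal Y}$, $\mathcal Y\in\mathcal D(G)$, are pairwise distinct, none of them can be omitted, and they are exactly the minimal primes of $I_G$. 5. The decomposition is independent of the base field: $\mathcal D(G)$ depends only on $G$, and for every field extension $\mathbb L/\mathbb K$ the ideals generated by $I_G$ and by $I_{G,\mathcal Y}$ ($\mathcal Y\subseteq\mathcal X$) in $\mathbb L[p_{ix}]$ are the corresponding ideals defined over $\mathbb L$; the extended ideals $I_{G,\mathcal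 Y}$ are again prime, and those with $\mathcal Y\in\mathcal D(G)$ form the minimal primary decomposition of the extended ideal $I_G$. -/

import Mathlib

universe u v

/-- The binomial `p_{ix} p_{jy} - p_{iy} p_{jx}`: the `2 × 2` minor with rows `i, j` and columns
`x, y` of the generic matrix of unknowns indexed by `X₀ × X`. -/
noncomputable def minorPoly (K : Type u) [Field K] {X₀ X : Type v} (i j : X₀) (x y : X) :
    MvPolynomial (X₀ × X) K :=
  MvPolynomial.X (i, x) * MvPolynomial.X (j, y) - MvPolynomial.X (i, y) * MvPolynomial.X (j, x)

/-- The (generalized) binomial edge ideal `I_G`, generated by the binomials of all edges. -/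
noncomputable def edgeIdeal (K : Type u) [Field K] (X₀ : Type v) {X : Type v}
    (G : SimpleGraph X) : Ideal (MvPolynomial (X₀ × X) K) :=
  Ideal.span {f | ∃ (i j : X₀) (x y : X), G.Adj x y ∧ f = minorPoly K i j x y}

/-- The vertices `x` and `y` both belong to `Y` and lie in the same connected component of the
induced subgraph `G_Y`. -/
def ConnectedWithin {X : Type v} (G : SimpleGraph X) (Y : Set X) (x y : X) : Prop :=
  ∃ (hx : x ∈ Y) (hy : y ∈ Y), (G.induce Y).Reachable ⟨x, hx⟩ ⟨y, hy⟩

/-- The ideal `I_{G,Y}`, generated by the unknowns `p_{ix}` with `x ∉ Y` and the `2 × 2` minors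
whose two columns lie in the same connected component of `G_Y`. -/
noncomputable def componentIdeal (K : Type u) [Field K] (X₀ : Type v) {X : Type v}
    (G : SimpleGraph X) (Y : Set X) : Ideal (MvPolynomial (X₀ × X) K) :=
  Ideal.span ({f | ∃ (i : X₀) (x : X), x ∉ Y ∧ f = MvPolynomial.X (i, x)} ∪
    {f | ∃ (i j : X₀) (x y : X), ConnectedWithin G Y x y ∧ f = minorPoly K i j x y})

/-- The number of connected components of the induced subgraph `G_Y`. -/
noncomputable def numComponents {X : Type v} (G : SimpleGraph X) (Y : Set X) : ℕ :=
  Nat.card (G.induce Y).ConnectedComponent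

/-- Every vertex `x` outside `Y` has two neighbours `y, z` in `Y` that are not connected
in `G_Y`. -/
def JoinsOutside {X : Type v} (G : SimpleGraph X) (Y : Set X) : Prop :=
  ∀ x ∉ Y, ∃ y ∈ Y, ∃ z ∈ Y, G.Adj x y ∧ G.Adj x z ∧ ¬ ConnectedWithin G Y y z

open Classical in
/-- The finite collection of all vertex sets `Y` such that adding any single vertex outside `Y`
strictly decreases the number of connected components of the induced subgraph. -/
noncomputable def decompositionIndex {X : Type v} [Fintype X] (G : SimpleGraph X) :
    Finset (Set X) :=
  Finset.univ.filter fun Y => ∀ x ∉ Y, numComponents G (insert x Y) < numComponents G Y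

/-- The affine scheme `Spec (K[σ] / I)` is rational over `K`, i.e. birational over `K` to an
affine space. -/
def IsRationalZeroScheme {K : Type u} [Field K] {σ : Type u} (I : Ideal (MvPolynomial σ K)) :
    Prop :=
  AlgebraicGeometry.Scheme.IsRationalOver (AlgebraicGeometry.Spec.map
    (CommRingCat.ofHom (algebraMap K (MvPolynomial σ K ⧸ I))))

-- Everything rests on monomial parametrizations. Let `φ_Y` send `p_{ix}` to `a_{i,C(x)} b_x` for `x
-- ∈ Y`, where `C(x)` is the component of `x` in `G_Y`, and to `0` otherwise. Monomials supported in
-- the columns `Y` have equal images exactly when they agree in column degrees and in row degrees on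
-- each component, and then exchanges of two entries within components lead from one to the other.
-- So the kernel of `φ_Y` is `I_{G,Y}` (`ker_parametrization`), which is therefore prime.
--
-- If `Y` is precisely the set of columns occurring in a monomial, these exchanges need only edge
-- binomials, since an exchange between distant columns can be carried along a walk through occupied
-- columns (`monomial_mul_minorPoly_mem_edgeIdeal`). Splitting polynomials by column support gives
-- `I_G` as the intersection over all `Y` (`edgeIdeal_eq_iInf_componentIdeal`).
--
-- A set `Y` outside `D(G)` can be enlarged without enlarging its ideal
-- (`exists_componentIdeal_insert_le`), while `I_{G,Y} ≤ I_{G,Z}` with `Z ∈ D(G)` forces `Y = Z`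
-- (`eq_of_componentIdeal_le`); this yields the irredundant decomposition and the minimal primes.
-- Rationality comes from a chart of blocks of rank at most one: one row and one column per
-- component determine the other entries.

universe w

/-! ### Components of induced subgraphs when one vertex is added. -/

section Graph

variable {X : Type v} {G : SimpleGraph X} {Y Z : Set X} {x y z : X}

theorem ConnectedWithin.left_mem (h : ConnectedWithin G Y x y) : x ∈ Y := h.1

theorem ConnectedWithin.right_mem (h : ConnectedWithin G Y x y) : y ∈ Y := h.2.1

theorem ConnectedWithin.refl (hx : x ∈ Y) : ConnectedWithin G Y x x := ⟨hx, hx, .refl _⟩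

theorem ConnectedWithin.symm (h : ConnectedWithin G Y x y) : ConnectedWithin G Y y x :=
  ⟨h.2.1, h.1, h.2.2.symm⟩

theorem ConnectedWithin.trans (h : ConnectedWithin G Y x y) (h' : ConnectedWithin G Y y z) :
    ConnectedWithin G Y x z :=
  ⟨h.1, h'.2.1, h.2.2.trans h'.2.2⟩

theorem ConnectedWithin.of_adj (hx : x ∈ Y) (hy : y ∈ Y) (h : G.Adj x y) :
    ConnectedWithin G Y x y :=
  ⟨hx, hy, SimpleGraph.Adj.reachable (by simpa using h)⟩

/-- The vertex set of the connected component of `x` in `G_Y`; empty if `x ∉ Y`. -/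
def componentClass (G : SimpleGraph X) (Y : Set X) (x : X) : Set X :=
  {y | ConnectedWithin G Y x y}

theorem componentClass_eq_of_connectedWithin (h : ConnectedWithin G Y x y) :
    componentClass G Y x = componentClass G Y y :=
  Set.ext fun _ => ⟨fun h' => h.symm.trans h', fun h' => h.trans h'⟩

theorem connectedWithin_of_componentClass_eq (hx : x ∈ Y)
    (h : componentClass G Y x = componentClass G Y y) : ConnectedWithin G Y x y := by
  have : x ∈ componentClass G Y x := ConnectedWithin.refl hx
  rw [h] at this
  exact ConnectedWithin.symm this

/-- A walk through an additional vertex all of whose neighbours in `Y` are connected to each other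
can be rerouted inside `Y`. -/
theorem ConnectedWithin.of_insert
    (hx : ∀ y ∈ Y, ∀ z ∈ Y, G.Adj x y → G.Adj x z → ConnectedWithin G Y y z)
    (hy : y ∈ Y) (hz : z ∈ Y) (h : ConnectedWithin G (insert x Y) y z) :
    ConnectedWithin G Y y z := by
  by_cases hxY : x ∈ Y
  · rwa [Set.insert_eq_of_mem hxY] at h
  obtain ⟨_, _, ⟨w⟩⟩ := h
  -- The second clause carries the induction through visits to `x`: a walk starting there is
  -- replaced by one from any neighbour of `x` in `Y`.
  suffices H : ∀ a b : ↥(insert x Y), (G.induce (insert x Y)).Walk a b → b.1 ∈ Y →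
      (a.1 ∈ Y → ConnectedWithin G Y a b) ∧
      (a.1 = x → ∀ y ∈ Y, G.Adj x y → ConnectedWithin G Y y b) from (H _ _ w hz).1 hy
  intro a b w
  induction w with
  | nil => exact fun hb => ⟨fun ha => .refl ha, fun ha => absurd (ha ▸ hb) hxY⟩
  | @cons a c b hac _ ih =>
    intro hb
    have hac : G.Adj a c := by simpa using hac
    refine ⟨fun ha => ?_, fun ha y hy hxy => ?_⟩
    · rcases c.2 with hc | hc
      · exact (ih hb).2 hc a ha (by rw [hc] at hac; exact hac.symm)
      · exact (ConnectedWithin.of_adj ha hc hac).trans ((ih hb).1 hc)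
    · rcases c.2 with hc | hc
      · exact absurd (ha.trans hc.symm) hac.ne
      · exact (hx y hy c hc hxy (by rw [ha] at hac; exact hac)).trans ((ih hb).1 hc)

/-- The inclusion induces a map `f` on components. It is injective when the neighbours of `x` in `Y`
lie in one component, so the number cannot drop; it is surjective once `x` has a neighbour in `Y`,
and then the number drops if `f` identifies two components. -/
theorem numComponents_insert_lt_iff [Finite X] (hx : x ∉ Y) :
    numComponents G (insert x Y) < numComponents G Y ↔
      ∃ y ∈ Y, ∃ z ∈ Y, G.Adj x y ∧ G.Adj x z ∧ ¬ ConnectedWithin G Y y z := by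
  let e : G.induce Y →g G.induce (insert x Y) :=
    (G.induceHomOfLE (Set.subset_insert x Y)).toHom
  let f : (G.induce Y).ConnectedComponent → (G.induce (insert x Y)).ConnectedComponent :=
    SimpleGraph.ConnectedComponent.map e
  constructor
  · intro h
    by_contra! hcon
    refine absurd h (not_lt.mpr (Nat.card_le_card_of_injective f ?_))
    intro c d
    induction c using SimpleGraph.ConnectedComponent.ind with | _ a
    induction d using SimpleGraph.ConnectedComponent.ind with | _ b
    intro hab
    have hab : (G.induce (insert x Y)).Reachable (e a) (e b) :=
      SimpleGraph.ConnectedComponent.eq.mp hab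
    exact SimpleGraph.ConnectedComponent.eq.mpr
      (ConnectedWithin.of_insert hcon a.2 b.2 ⟨_, _, hab⟩).2.2
  · rintro ⟨y, hy, z, hz, hxy, hxz, hyz⟩
    have hxi : x ∈ insert x Y := Set.mem_insert x Y
    have key : ∀ y (hy : y ∈ Y), G.Adj x y →
        f ((G.induce Y).connectedComponentMk ⟨y, hy⟩) =
          (G.induce (insert x Y)).connectedComponentMk ⟨x, hxi⟩ := fun y hy hxy =>
      SimpleGraph.ConnectedComponent.eq.mpr
        (ConnectedWithin.of_adj (Set.mem_insert_of_mem x hy) hxi hxy.symm).2.2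
    have hsurj : Function.Surjective f := by
      intro c
      induction c using SimpleGraph.ConnectedComponent.ind with | _ a
      obtain ⟨a, rfl | ha⟩ := a
      · exact ⟨_, key y hy hxy⟩
      · exact ⟨(G.induce Y).connectedComponentMk ⟨a, ha⟩, rfl⟩
    have hninj : ¬ Function.Injective f := fun hf => hyz
      ⟨hy, hz, SimpleGraph.ConnectedComponent.eq.mp
        (hf ((key y hy hxy).trans (key z hz hxz).symm))⟩
    exact lt_of_le_of_ne (Nat.card_le_card_of_surjective f hsurj) fun h =>
      hninj ((Nat.bijective_iff_surjective_and_card f).mpr ⟨hsurj, h.symm⟩).1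

theorem mem_decompositionIndex_iff [Fintype X] : Y ∈ decompositionIndex G ↔ JoinsOutside G Y := by
  simp only [decompositionIndex, Finset.mem_filter, Finset.mem_univ, true_and, JoinsOutside]
  exact forall₂_congr fun x hx => numComponents_insert_lt_iff hx

end Graph

/-! ### Congruences between monomials modulo the edge ideal. -/

section Monomials

open MvPolynomial

variable {K : Type u} [Field K] {X₀ X : Type v} {G : SimpleGraph X} {Y Z : Set X}

theorem minorPoly_mem_edgeIdeal {x y : X} (h : G.Adj x y) (i j : X₀) :
    minorPoly K i j x y ∈ edgeIdeal K X₀ G :=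
  Ideal.subset_span ⟨i, j, x, y, h, rfl⟩

theorem minorPoly_mem_componentIdeal {x y : X} (h : ConnectedWithin G Y x y) (i j : X₀) :
    minorPoly K i j x y ∈ componentIdeal K X₀ G Y :=
  Ideal.subset_span (Or.inr ⟨i, j, x, y, h, rfl⟩)

theorem X_mem_componentIdeal {x : X} (h : x ∉ Y) (i : X₀) :
    (MvPolynomial.X (i, x) : MvPolynomial (X₀ × X) K) ∈ componentIdeal K X₀ G Y :=
  Ideal.subset_span (Or.inl ⟨i, x, h, rfl⟩)

/-- Along a walk through columns in which a monomial has support, the entries of the two end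
columns can be exchanged modulo the edge ideal. -/
theorem monomial_mul_minorPoly_mem_edgeIdeal {x y : Z} (w : (G.induce Z).Walk x y) (i j : X₀)
    (n : X₀ × X →₀ ℕ) (hn : ∀ z ∈ Z, z ≠ x → z ≠ y → ∃ k, n (k, z) ≠ 0) :
    monomial n (1 : K) * minorPoly K i j x.1 y.1 ∈ edgeIdeal K X₀ G := by
  classical
  induction w generalizing n with
  | nil => simp [minorPoly, mul_comm]
  | @cons x z y hxz w ih =>
    have hxz : G.Adj x z := by simpa using hxz
    by_cases hxy : (x : X) = y
    · simp [minorPoly, hxy, mul_comm]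
    by_cases hzy : (z : X) = y
    · exact Ideal.mul_mem_left _ _ (minorPoly_mem_edgeIdeal (hzy ▸ hxz) i j)
    obtain ⟨k, hk⟩ := hn z z.2 hxz.ne' hzy
    have hle : Finsupp.single (k, z.1) 1 ≤ n := by
      simpa [Finsupp.single_le_iff, Nat.one_le_iff_ne_zero] using hk
    obtain ⟨m, rfl⟩ := exists_add_of_le hle
    -- Trade `p_{kz}` for `p_{kx}`: for the shorter walk from `z`, the column `x` must carry support
    -- and `z` no longer has to.
    have hm := ih (m + Finsupp.single (k, x.1) 1) (fun v hv hvz hvy => by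
      by_cases hvx : v = x
      · exact ⟨k, by simp [hvx]⟩
      · obtain ⟨l, hl⟩ := hn v hv hvx hvy
        refine ⟨l, ?_⟩
        have : (k, z.1) ≠ (l, v) := fun h => hvz (Prod.ext_iff.mp h).2.symm
        simp only [Finsupp.add_apply, Finsupp.single_eq_of_ne' this] at hl ⊢
        omega)
    have hg : ∀ a b : X₀, minorPoly K a b x.1 z.1 ∈ edgeIdeal K X₀ G := minorPoly_mem_edgeIdeal hxz
    have key : monomial (Finsupp.single (k, z.1) 1 + m) (1 : K) * minorPoly K i j x.1 y.1 =
        monomial (m + Finsupp.single (k, x.1) 1) 1 * minorPoly K i j z.1 y.1 +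
          monomial m 1 * MvPolynomial.X (j, y.1) * minorPoly K i k x.1 z.1 +
          monomial m 1 * MvPolynomial.X (i, y.1) * minorPoly K k j x.1 z.1 := by
      have h1 : ∀ p : X₀ × X, monomial (m + Finsupp.single p 1) (1 : K) =
          monomial m 1 * MvPolynomial.X p := fun p => by
        rw [MvPolynomial.X, monomial_mul, one_mul]
      rw [add_comm, h1, h1]
      simp only [minorPoly]
      ring
    rw [key]
    exact add_mem (add_mem hm (Ideal.mul_mem_left _ _ (hg _ _))) (Ideal.mul_mem_left _ _ (hg _ _))

theorem Finsupp.exists_ne_zero_of_mapDomain_eq {α β : Type*} {f : α → β} {m m' : α →₀ ℕ}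
    (h : m.mapDomain f = m'.mapDomain f) {a : α} (ha : m a ≠ 0) : ∃ b, m' b ≠ 0 ∧ f b = f a := by
  classical
  have hle : Finsupp.single a 1 ≤ m := by
    simpa [Finsupp.single_le_iff, Nat.one_le_iff_ne_zero] using ha
  obtain ⟨n, rfl⟩ := exists_add_of_le hle
  have : f a ∈ (m'.mapDomain f).support := by
    rw [← h, Finsupp.mapDomain_add, Finsupp.mapDomain_single]
    simp
  obtain ⟨b, hb, hba⟩ := Finset.mem_image.mp (Finsupp.mapDomain_support this)
  exact ⟨b, Finsupp.mem_support_iff.mp hb, hba⟩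

/-- Two monomials with the same column degrees and the same row degrees within every connected
component of the graph induced on their columns are congruent modulo the edge ideal. -/
theorem monomial_add_sub_monomial_add_mem_edgeIdeal {κ : Type*} (c : X → κ)
    (hc : ∀ x ∈ Z, ∀ y ∈ Z, c x = c y → ConnectedWithin G Z x y) (n m m' : X₀ × X →₀ ℕ)
    (hZ : ∀ z ∈ Z, ∃ k, (n + m) (k, z) ≠ 0) (hm : ∀ p, m p ≠ 0 → p.2 ∈ Z)
    (hcol : m.mapDomain Prod.snd = m'.mapDomain Prod.snd)
    (hrow : m.mapDomain (Prod.map id c) = m'.mapDomain (Prod.map id c)) :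
    monomial (n + m) (1 : K) - monomial (n + m') 1 ∈ edgeIdeal K X₀ G := by
  classical
  -- The monomial `n` collects the factors already matched; they still count as support in the
  -- columns `Z`.
  induction hd : m.degree generalizing n m m' with
  | zero =>
    rw [Finsupp.degree_eq_zero_iff] at hd
    subst hd
    have : m' = 0 := by
      ext p
      by_contra hp
      obtain ⟨q, hq, -⟩ := Finsupp.exists_ne_zero_of_mapDomain_eq hcol.symm hp
      exact hq rfl
    simp [this]
  | succ d ih =>
    have hm0 : m ≠ 0 := by rintro rfl; simp at hd
    obtain ⟨⟨i, x⟩, hix⟩ := Finsupp.ne_iff.mp hm0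
    have hle : ∀ {m : X₀ × X →₀ ℕ} {p : X₀ × X}, m p ≠ 0 → ∃ m₁, m = Finsupp.single p 1 + m₁ :=
      fun {m p} h => exists_add_of_le (by
        simpa [Finsupp.single_le_iff, Nat.one_le_iff_ne_zero] using h)
    obtain ⟨m₁, rfl⟩ := hle hix
    have hd₁ : m₁.degree = d := by
      simp only [map_add, Finsupp.degree_single] at hd; omega
    have step : ∀ m₁', (Finsupp.single (i, x) 1 + m₁).mapDomain Prod.snd =
          (Finsupp.single (i, x) 1 + m₁').mapDomain Prod.snd →
        (Finsupp.single (i, x) 1 + m₁).mapDomain (Prod.map id c) =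
          (Finsupp.single (i, x) 1 + m₁').mapDomain (Prod.map id c) →
        monomial (n + (Finsupp.single (i, x) 1 + m₁)) (1 : K) -
          monomial (n + (Finsupp.single (i, x) 1 + m₁')) 1 ∈ edgeIdeal K X₀ G := by
      intro m₁' h₁ h₂
      rw [Finsupp.mapDomain_add, Finsupp.mapDomain_add, add_right_inj] at h₁ h₂
      rw [← add_assoc, ← add_assoc]
      refine ih _ _ _ (fun z hz => by rw [add_assoc]; exact hZ z hz) (fun p hp => hm p ?_) h₁ h₂ hd₁
      rw [Finsupp.add_apply]; omega
    by_cases hix' : m' (i, x) = 0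
    swap
    · obtain ⟨m₁', rfl⟩ := hle hix'
      exact step _ hcol hrow
    -- Row degrees provide a factor `p_{iy}` of `m'` with `y` in the component of `x`, column
    -- degrees a factor `p_{jx}`. Exchanging them for `p_{ix} p_{jy}` costs a multiple of a minor
    -- and creates the common factor `p_{ix}`, which `step` cancels.
    obtain ⟨⟨i', y⟩, hiy, hiy'⟩ := Finsupp.exists_ne_zero_of_mapDomain_eq hrow hix
    obtain ⟨rfl, hcy⟩ : i' = i ∧ c y = c x := by simpa using hiy'
    obtain ⟨⟨j, x'⟩, hjx, hjx'⟩ := Finsupp.exists_ne_zero_of_mapDomain_eq hcol hix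
    obtain rfl : x' = x := hjx'
    have hij : (i', y) ≠ (j, x') := by
      intro h
      obtain ⟨rfl, rfl⟩ := Prod.ext_iff.mp h
      exact hiy hix'
    obtain ⟨m₂, rfl⟩ := hle hiy
    rw [Finsupp.add_apply, Finsupp.single_eq_of_ne' hij, zero_add] at hjx
    obtain ⟨m₂, rfl⟩ := hle hjx
    have hx : x' ∈ Z := hm _ hix
    have hy : y ∈ Z := by
      obtain ⟨⟨k, y'⟩, hq, hq'⟩ := Finsupp.exists_ne_zero_of_mapDomain_eq hcol.symm hiy
      obtain rfl : y' = y := hq'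
      exact hm _ hq
    obtain ⟨_, _, ⟨w⟩⟩ := hc x' hx y hy hcy.symm
    have h₁ := step (Finsupp.single (j, y) 1 + m₂)
      (hcol.trans (by simp only [Finsupp.mapDomain_add, Finsupp.mapDomain_single]; exact add_left_comm _ _ _))
      (hrow.trans (by
        simp only [Finsupp.mapDomain_add, Finsupp.mapDomain_single, Prod.map_apply, id, hcy]))
    have h₂ := monomial_mul_minorPoly_mem_edgeIdeal (K := K) w i' j (n + m₂) (by
      intro z hz hzx hzy
      have hcol' : (n + (Finsupp.single (i', x') 1 + m₁)).mapDomain Prod.snd =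
          (n + (Finsupp.single (i', y) 1 + (Finsupp.single (j, x') 1 + m₂))).mapDomain
            Prod.snd := by
        rw [Finsupp.mapDomain_add, hcol, ← Finsupp.mapDomain_add]
      obtain ⟨k, hk⟩ := hZ z hz
      obtain ⟨⟨l, z'⟩, hl, hl'⟩ := Finsupp.exists_ne_zero_of_mapDomain_eq hcol' hk
      obtain rfl : z' = z := hl'
      refine ⟨l, ?_⟩
      have e₁ : (i', y) ≠ (l, z') := fun h => hzy (Prod.ext_iff.mp h).2.symm
      have e₂ : (j, x') ≠ (l, z') := fun h => hzx (Prod.ext_iff.mp h).2.symm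
      simpa only [Finsupp.add_apply, Finsupp.single_eq_of_ne' e₁, Finsupp.single_eq_of_ne' e₂,
        zero_add] using hl)
    have key : monomial (n + (Finsupp.single (i', x') 1 + m₁)) (1 : K) -
        monomial (n + (Finsupp.single (i', y) 1 + (Finsupp.single (j, x') 1 + m₂))) 1 =
        (monomial (n + (Finsupp.single (i', x') 1 + m₁)) (1 : K) -
          monomial (n + (Finsupp.single (i', x') 1 + (Finsupp.single (j, y) 1 + m₂))) 1) +
        monomial (n + m₂) 1 * minorPoly K i' j x' y := by
      have e : ∀ p q : X₀ × X,
          monomial (n + (Finsupp.single p 1 + (Finsupp.single q 1 + m₂))) (1 : K) =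
            monomial (n + m₂) 1 * (MvPolynomial.X p * MvPolynomial.X q) := fun p q => by
        rw [MvPolynomial.X, MvPolynomial.X, monomial_mul, monomial_mul, one_mul, one_mul,
          add_assoc n, add_comm m₂, add_assoc]
      rw [e, e, minorPoly]
      ring
    rw [key]
    exact add_mem h₁ h₂

end Monomials

/-! ### The kernels of the parametrizations and their intersection. -/

section Parametrization

open MvPolynomial

variable {K : Type u} [Field K] {X₀ X : Type v} {G : SimpleGraph X} {Y Z : Set X}

/-- The set of columns in which a monomial has support. -/
def columnSupport (m : X₀ × X →₀ ℕ) : Set X := {x | ∃ i, m (i, x) ≠ 0}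

theorem columnSupport_eq (m : X₀ × X →₀ ℕ) :
    columnSupport m = {x | m.mapDomain Prod.snd x ≠ 0} := by
  classical
  ext x
  constructor
  · rintro ⟨i, hi⟩
    have hle : Finsupp.single (i, x) 1 ≤ m := by
      simpa [Finsupp.single_le_iff, Nat.one_le_iff_ne_zero] using hi
    obtain ⟨n, rfl⟩ := exists_add_of_le hle
    simp [Finsupp.mapDomain_add, Finsupp.mapDomain_single]
  · intro hx
    obtain ⟨⟨i, y⟩, hb, rfl⟩ := Finset.mem_image.mp
      (Finsupp.mapDomain_support (Finsupp.mem_support_iff.mpr hx))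
    exact ⟨i, Finsupp.mem_support_iff.mp hb⟩

open Classical in
/-- The parametrization of the zero set of `I_{G,Y}`: the unknown `p_{ix}` is sent to the product
of a row parameter, which depends on the component of `x` in `G_Y`, and a column parameter. -/
noncomputable def parametrization (K : Type u) [Field K] (X₀ : Type v) {X : Type v}
    (G : SimpleGraph X) (Y : Set X) :
    MvPolynomial (X₀ × X) K →ₐ[K] MvPolynomial ((X₀ × Set X) ⊕ X) K :=
  aeval fun p => if p.2 ∈ Y then
    MvPolynomial.X (Sum.inl (p.1, componentClass G Y p.2)) * MvPolynomial.X (Sum.inr p.2) else 0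

/-- The action of `parametrization` on the exponents of monomials. -/
noncomputable def paramExponent (G : SimpleGraph X) (Y : Set X) (m : X₀ × X →₀ ℕ) :
    ((X₀ × Set X) ⊕ X) →₀ ℕ :=
  Finsupp.sumFinsuppAddEquivProdFinsupp.symm
    (m.mapDomain (Prod.map id (componentClass G Y)), m.mapDomain Prod.snd)

theorem mapDomain_eq_of_paramExponent_eq {m m' : X₀ × X →₀ ℕ}
    (h : paramExponent G Y m = paramExponent G Y m') :
    m.mapDomain (Prod.map id (componentClass G Y)) =
        m'.mapDomain (Prod.map id (componentClass G Y)) ∧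
      m.mapDomain Prod.snd = m'.mapDomain Prod.snd :=
  Prod.ext_iff.mp (Finsupp.sumFinsuppAddEquivProdFinsupp.symm.injective h)

theorem paramExponent_inr (m : X₀ × X →₀ ℕ) (x : X) :
    paramExponent G Y m (Sum.inr x) = m.mapDomain Prod.snd x := by
  simp [paramExponent]

theorem parametrization_monomial {m : X₀ × X →₀ ℕ} (hm : columnSupport m ⊆ Y) :
    parametrization K X₀ G Y (monomial m 1) = monomial (paramExponent G Y m) 1 := by
  classical
  induction m using Finsupp.induction_linear with
  | zero => simp [paramExponent]
  | add m n h₁ h₂ =>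
    have e : paramExponent G Y (m + n) = paramExponent G Y m + paramExponent G Y n := by
      simp only [paramExponent, Finsupp.mapDomain_add, ← map_add, Prod.mk_add_mk]
    rw [e, ← one_mul (1 : K), ← monomial_mul, ← monomial_mul, map_mul, h₁, h₂]
    · rintro x ⟨i, hi⟩; exact hm ⟨i, by simp only [Finsupp.add_apply]; omega⟩
    · rintro x ⟨i, hi⟩; exact hm ⟨i, by simp only [Finsupp.add_apply]; omega⟩
  | single p k =>
    rcases eq_or_ne k 0 with rfl | hk
    · simp [paramExponent]
    · have hp : p.2 ∈ Y := hm ⟨p.1, by simpa using hk⟩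
      have e : paramExponent G Y (Finsupp.single p k) =
          Finsupp.single (Sum.inl (p.1, componentClass G Y p.2)) k +
            Finsupp.single (Sum.inr p.2) k := by
        ext (a | a) <;> simp [paramExponent, Finsupp.mapDomain_single, Finsupp.single_apply,
          Prod.map]
      rw [e, parametrization, aeval_monomial, Finsupp.prod_single_index (by rw [pow_zero]), if_pos hp,
        mul_pow, X_pow_eq_monomial, X_pow_eq_monomial, monomial_mul]
      simp

theorem parametrization_monomial_of_not_subset {m : X₀ × X →₀ ℕ} (hm : ¬ columnSupport m ⊆ Y) :
    parametrization K X₀ G Y (monomial m 1) = 0 := by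
  classical
  obtain ⟨x, ⟨i, hi⟩, hx⟩ := Set.not_subset.mp hm
  rw [parametrization, aeval_monomial, Finsupp.prod,
    Finset.prod_eq_zero (Finsupp.mem_support_iff.mpr hi), mul_zero]
  simp [hx, hi]

theorem paramExponent_columnSupport (m : X₀ × X →₀ ℕ) :
    {x | paramExponent G Y m (Sum.inr x) ≠ 0} = columnSupport m := by
  simp only [paramExponent_inr, columnSupport_eq]

/-- Monomials with equal images under the parametrization are congruent modulo `I_{G,Y}`. -/
theorem monomial_sub_monomial_mem_componentIdeal {m m' : X₀ × X →₀ ℕ} (hm : columnSupport m ⊆ Y)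
    (h : paramExponent G Y m = paramExponent G Y m') :
    monomial m (1 : K) - monomial m' 1 ∈ componentIdeal K X₀ G Y := by
  obtain ⟨hrow, hcol⟩ := mapDomain_eq_of_paramExponent_eq h
  -- The columns of `m` may be too few to connect inside `G`, so each component of `G_Y` is made
  -- complete; its minors are all available in `I_{G,Y}`.
  let G' : SimpleGraph X :=
    { Adj := fun x y => x ≠ y ∧ ConnectedWithin G Y x y
      symm := ⟨fun _ _ h => ⟨h.1.symm, h.2.symm⟩⟩
      loopless := ⟨fun _ h => h.1 rfl⟩ }
  have hle : edgeIdeal K X₀ G' ≤ componentIdeal K X₀ G Y := by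
    refine Ideal.span_le.mpr ?_
    rintro _ ⟨i, j, x, y, hxy, rfl⟩
    exact minorPoly_mem_componentIdeal hxy.2 i j
  have := monomial_add_sub_monomial_add_mem_edgeIdeal (K := K) (G := G') (Z := columnSupport m)
    (componentClass G Y) (fun x hx y hy hxy => by
      by_cases hne : x = y
      · exact hne ▸ .refl hx
      · exact .of_adj hx hy ⟨hne, connectedWithin_of_componentClass_eq (hm hx) hxy⟩)
    0 m m' (fun z hz => by simpa [columnSupport] using hz)
    (fun p hp => ⟨p.1, hp⟩) hcol hrow
  simpa using hle this

/-- Monomials supported precisely in the columns `Y` with equal images under the parametrization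
are congruent modulo `I_G`. -/
theorem monomial_sub_monomial_mem_edgeIdeal {m m' : X₀ × X →₀ ℕ}
    (h : paramExponent G (columnSupport m) m = paramExponent G (columnSupport m) m') :
    monomial m (1 : K) - monomial m' 1 ∈ edgeIdeal K X₀ G := by
  obtain ⟨hrow, hcol⟩ := mapDomain_eq_of_paramExponent_eq h
  have := monomial_add_sub_monomial_add_mem_edgeIdeal (K := K) (G := G) (Z := columnSupport m)
    (componentClass G (columnSupport m))
    (fun x hx y _ hxy => connectedWithin_of_componentClass_eq hx hxy)
    0 m m' (fun z hz => by simpa [columnSupport] using hz)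
    (fun p hp => ⟨p.1, hp⟩) hcol hrow
  simpa using this

theorem parametrization_X (i : X₀) {x : X} (hx : x ∈ Y) :
    parametrization K X₀ G Y (MvPolynomial.X (i, x)) =
      MvPolynomial.X (Sum.inl (i, componentClass G Y x)) * MvPolynomial.X (Sum.inr x) := by
  simp [parametrization, hx]

theorem parametrization_X_of_notMem (i : X₀) {x : X} (hx : x ∉ Y) :
    parametrization K X₀ G Y (MvPolynomial.X (i, x)) = 0 := by
  simp [parametrization, hx]

theorem componentIdeal_le_ker_parametrization :
    componentIdeal K X₀ G Y ≤ RingHom.ker (parametrization K X₀ G Y) := by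
  refine Ideal.span_le.mpr ?_
  rintro _ (⟨i, x, hx, rfl⟩ | ⟨i, j, x, y, h, rfl⟩)
  · exact parametrization_X_of_notMem i hx
  · simp only [SetLike.mem_coe, RingHom.mem_ker, minorPoly, map_sub, map_mul,
      parametrization_X _ h.left_mem, parametrization_X _ h.right_mem,
      componentClass_eq_of_connectedWithin h]
    ring

/-- A linear map `s` picks one preimage of each monomial in the image. Modulo `I_{G,Y}`, `s` after
the parametrization is the identity on monomials, so a polynomial with image `0` is congruent to
`0`. -/
theorem ker_parametrization :
    RingHom.ker (parametrization K X₀ G Y) = componentIdeal K X₀ G Y := by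
  classical
  refine le_antisymm (fun f hf => ?_) componentIdeal_le_ker_parametrization
  let s : MvPolynomial ((X₀ × Set X) ⊕ X) K →ₗ[K] MvPolynomial (X₀ × X) K :=
    (basisMonomials _ K).constr K fun e =>
      if {x | e (Sum.inr x) ≠ 0} ⊆ Y then monomial (Function.invFun (paramExponent G Y) e) 1 else 0
  have hs : ∀ e, s (monomial e 1) = if {x | e (Sum.inr x) ≠ 0} ⊆ Y then
      monomial (Function.invFun (paramExponent G Y) e) 1 else 0 := fun e => by
    have h := (basisMonomials ((X₀ × Set X) ⊕ X) K).constr_basis K (fun e =>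
      if {x | e (Sum.inr x) ≠ 0} ⊆ Y then monomial (Function.invFun (paramExponent G Y) e) (1 : K)
      else 0) e
    rwa [coe_basisMonomials] at h
  have key : ((componentIdeal K X₀ G Y).restrictScalars K).mkQ =
      ((componentIdeal K X₀ G Y).restrictScalars K).mkQ ∘ₗ s ∘ₗ
        (parametrization K X₀ G Y).toLinearMap := by
    refine (basisMonomials _ K).ext fun m => ?_
    simp only [coe_basisMonomials, LinearMap.comp_apply, AlgHom.toLinearMap_apply]
    by_cases hm : columnSupport m ⊆ Y
    · rw [parametrization_monomial hm, hs, paramExponent_columnSupport, if_pos hm,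
        ← sub_eq_zero, ← map_sub, Submodule.mkQ_apply, Submodule.Quotient.mk_eq_zero]
      exact monomial_sub_monomial_mem_componentIdeal hm
        (Function.invFun_eq (f := paramExponent G Y) ⟨m, rfl⟩).symm
    · rw [parametrization_monomial_of_not_subset hm, map_zero, map_zero, Submodule.mkQ_apply,
        Submodule.Quotient.mk_eq_zero]
      obtain ⟨x, ⟨i, hi⟩, hx⟩ := Set.not_subset.mp hm
      have hle : Finsupp.single (i, x) 1 ≤ m := by
        simpa [Finsupp.single_le_iff, Nat.one_le_iff_ne_zero] using hi
      obtain ⟨n, rfl⟩ := exists_add_of_le hle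
      rw [← one_mul (1 : K), ← monomial_mul]
      exact Ideal.mul_mem_right _ _ (X_mem_componentIdeal hx i)
  have := LinearMap.congr_fun key f
  rw [LinearMap.comp_apply, LinearMap.comp_apply, AlgHom.toLinearMap_apply,
    show parametrization K X₀ G Y f = 0 from hf, map_zero, map_zero, Submodule.mkQ_apply,
    Submodule.Quotient.mk_eq_zero] at this
  exact this

theorem isPrime_componentIdeal (K : Type u) [Field K] (X₀ : Type v) {X : Type v}
    (G : SimpleGraph X) (Y : Set X) : (componentIdeal K X₀ G Y).IsPrime :=
  ker_parametrization (K := K) (X₀ := X₀) (G := G) (Y := Y) ▸ RingHom.ker_isPrime _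

theorem edgeIdeal_le_componentIdeal : edgeIdeal K X₀ G ≤ componentIdeal K X₀ G Y := by
  refine Ideal.span_le.mpr ?_
  rintro _ ⟨i, j, x, y, hxy, rfl⟩
  by_cases hx : x ∈ Y
  · by_cases hy : y ∈ Y
    · exact minorPoly_mem_componentIdeal (.of_adj hx hy hxy) i j
    · exact sub_mem (Ideal.mul_mem_left _ _ (X_mem_componentIdeal hy _))
        (Ideal.mul_mem_right _ _ (X_mem_componentIdeal hy _))
  · exact sub_mem (Ideal.mul_mem_right _ _ (X_mem_componentIdeal hx _))
      (Ideal.mul_mem_left _ _ (X_mem_componentIdeal hx _))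

/-- The column parameters in an image monomial reveal the column support. Hence `s Z` can discard
all terms whose support is not exactly `Z`, and the sum over `Z` of `s Z` after the parametrization
of `Z` is the identity modulo `I_G`. -/
theorem edgeIdeal_eq_iInf_componentIdeal [Finite X] :
    edgeIdeal K X₀ G = ⨅ Y, componentIdeal K X₀ G Y := by
  classical
  have := Fintype.ofFinite X
  refine le_antisymm (le_iInf fun Y => edgeIdeal_le_componentIdeal) fun f hf => ?_
  let s (Z : Set X) : MvPolynomial ((X₀ × Set X) ⊕ X) K →ₗ[K] MvPolynomial (X₀ × X) K :=
    (basisMonomials _ K).constr K fun e =>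
      if {x | e (Sum.inr x) ≠ 0} = Z then monomial (Function.invFun (paramExponent G Z) e) 1 else 0
  have hs : ∀ Z e, s Z (monomial e 1) = if {x | e (Sum.inr x) ≠ 0} = Z then
      monomial (Function.invFun (paramExponent G Z) e) 1 else 0 := fun Z e => by
    have h := (basisMonomials ((X₀ × Set X) ⊕ X) K).constr_basis K (fun e =>
      if {x | e (Sum.inr x) ≠ 0} = Z then monomial (Function.invFun (paramExponent G Z) e) (1 : K)
      else 0) e
    rwa [coe_basisMonomials] at h
  have key : ((edgeIdeal K X₀ G).restrictScalars K).mkQ =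
      ((edgeIdeal K X₀ G).restrictScalars K).mkQ ∘ₗ
        ∑ Z, s Z ∘ₗ (parametrization K X₀ G Z).toLinearMap := by
    refine (basisMonomials _ K).ext fun m => ?_
    simp only [coe_basisMonomials, LinearMap.comp_apply, AlgHom.toLinearMap_apply,
      LinearMap.sum_apply]
    rw [Finset.sum_eq_single (columnSupport m) (fun Z _ hZ => ?_) (by simp),
      parametrization_monomial subset_rfl, hs, paramExponent_columnSupport, if_pos rfl,
      ← sub_eq_zero, ← map_sub, Submodule.mkQ_apply, Submodule.Quotient.mk_eq_zero]
    · exact monomial_sub_monomial_mem_edgeIdeal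
        (Function.invFun_eq (f := paramExponent G (columnSupport m)) ⟨m, rfl⟩).symm
    · by_cases hm : columnSupport m ⊆ Z
      · rw [parametrization_monomial hm, hs, paramExponent_columnSupport, if_neg hZ.symm]
      · rw [parametrization_monomial_of_not_subset hm, map_zero]
  have hf' : ∀ Z, parametrization K X₀ G Z f = 0 := fun Z =>
    componentIdeal_le_ker_parametrization ((Ideal.mem_iInf.mp hf) Z)
  have := LinearMap.congr_fun key f
  simp only [LinearMap.comp_apply, LinearMap.sum_apply, AlgHom.toLinearMap_apply, hf', map_zero,
    Finset.sum_const_zero] at this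
  rwa [Submodule.mkQ_apply, Submodule.Quotient.mk_eq_zero] at this

end Parametrization

/-! ### Irredundance and minimal primes. -/

section Decomposition

open MvPolynomial

variable {K : Type u} [Field K] {X₀ X : Type v} {G : SimpleGraph X} {Y Z : Set X}

/-- If all neighbours of `x` in `Y` are connected in `G_Y`, adding `x` merges no components; the new
minors involve column `x`, whose unknowns lie in `I_{G,Y}`. -/
theorem exists_componentIdeal_insert_le (h : ¬ JoinsOutside G Y) :
    ∃ x ∉ Y, componentIdeal K X₀ G (insert x Y) ≤ componentIdeal K X₀ G Y := by
  simp only [JoinsOutside, not_forall, not_exists, not_and, not_not] at h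
  obtain ⟨x, hx, h⟩ := h
  refine ⟨x, hx, Ideal.span_le.mpr ?_⟩
  rintro _ (⟨i, z, hz, rfl⟩ | ⟨i, j, y, z, hyz, rfl⟩)
  · exact X_mem_componentIdeal (fun hz' => hz (Set.mem_insert_of_mem x hz')) i
  by_cases hy : y ∈ Y
  · by_cases hz : z ∈ Y
    · exact minorPoly_mem_componentIdeal (.of_insert h hy hz hyz) i j
    · exact sub_mem (Ideal.mul_mem_left _ _ (X_mem_componentIdeal hz _))
        (Ideal.mul_mem_right _ _ (X_mem_componentIdeal hz _))
  · exact sub_mem (Ideal.mul_mem_right _ _ (X_mem_componentIdeal hy _))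
      (Ideal.mul_mem_left _ _ (X_mem_componentIdeal hy _))

theorem exists_joinsOutside_componentIdeal_le [Finite X] (Y : Set X) :
    ∃ Z, JoinsOutside G Z ∧ componentIdeal K X₀ G Z ≤ componentIdeal K X₀ G Y := by
  induction Y using WellFoundedGT.induction with | _ Y ih
  by_cases h : JoinsOutside G Y
  · exact ⟨Y, h, le_rfl⟩
  · obtain ⟨x, hx, hle⟩ := exists_componentIdeal_insert_le (K := K) (X₀ := X₀) h
    obtain ⟨Z, hZ, hZle⟩ := ih _ (Set.ssubset_insert hx)
    exact ⟨Z, hZ, hZle.trans hle⟩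

theorem edgeIdeal_eq_iInf_decompositionIndex [Fintype X] :
    edgeIdeal K X₀ G = ⨅ Y ∈ decompositionIndex G, componentIdeal K X₀ G Y := by
  refine le_antisymm (le_iInf₂ fun Y _ => edgeIdeal_le_componentIdeal) ?_
  rw [edgeIdeal_eq_iInf_componentIdeal]
  refine le_iInf fun Y => ?_
  obtain ⟨Z, hZ, hle⟩ := exists_joinsOutside_componentIdeal_le (K := K) (X₀ := X₀) (G := G) Y
  exact (iInf₂_le Z (mem_decompositionIndex_iff.mpr hZ)).trans hle

theorem X_mem_componentIdeal_iff {i : X₀} {x : X} :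
    (MvPolynomial.X (i, x) : MvPolynomial (X₀ × X) K) ∈ componentIdeal K X₀ G Y ↔ x ∉ Y := by
  refine ⟨fun h hx => ?_, fun h => X_mem_componentIdeal h i⟩
  have := componentIdeal_le_ker_parametrization h
  rw [RingHom.mem_ker, parametrization_X _ hx] at this
  exact mul_ne_zero (X_ne_zero _) (X_ne_zero _) this

theorem minorPoly_mem_componentIdeal_iff {i j : X₀} (hij : i ≠ j) {x y : X} (hx : x ∈ Y)
    (hy : y ∈ Y) : minorPoly K i j x y ∈ componentIdeal K X₀ G Y ↔ ConnectedWithin G Y x y := by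
  classical
  refine ⟨fun h => ?_, fun h => minorPoly_mem_componentIdeal h i j⟩
  by_contra hxy
  have hne : componentClass G Y x ≠ componentClass G Y y := fun h =>
    hxy (connectedWithin_of_componentClass_eq hx h)
  have := componentIdeal_le_ker_parametrization h
  rw [RingHom.mem_ker, minorPoly, map_sub, map_mul, map_mul, parametrization_X _ hx,
    parametrization_X _ hx, parametrization_X _ hy, parametrization_X _ hy] at this
  -- At this point the image of `p_{ix} p_{jy}` is `1` and that of `p_{iy} p_{jx}` is `0`.
  have := congrArg (MvPolynomial.eval (Sum.elim
    (fun p => if p = (i, componentClass G Y x) ∨ p = (j, componentClass G Y y) then (1 : K) else 0)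
    fun _ => 1)) this
  simp [hij, hne.symm] at this

/-- Comparing unknowns gives `Z ⊆ Y`. A vertex of `Y` outside `Z` would connect in `G_Y` two
vertices of `Z` not connected in `G_Z`, and their minor with two distinct rows would violate the
inclusion. -/
theorem eq_of_componentIdeal_le [Nontrivial X₀] (hZ : JoinsOutside G Z)
    (h : componentIdeal K X₀ G Y ≤ componentIdeal K X₀ G Z) : Y = Z := by
  obtain ⟨i, j, hij⟩ := exists_pair_ne X₀
  have hZY : Z ⊆ Y := fun x hx => by
    by_contra hxY
    exact X_mem_componentIdeal_iff.mp (h (X_mem_componentIdeal hxY i)) hx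
  refine subset_antisymm (fun x hx => ?_) hZY
  by_contra hxZ
  obtain ⟨y, hy, z, hz, hxy, hxz, hyz⟩ := hZ x hxZ
  exact hyz ((minorPoly_mem_componentIdeal_iff hij hy hz).mp (h (minorPoly_mem_componentIdeal
    ((ConnectedWithin.of_adj (hZY hy) hx hxy.symm).trans (.of_adj hx (hZY hz) hxz)) i j)))

theorem injOn_componentIdeal [Nontrivial X₀] [Fintype X] :
    Set.InjOn (componentIdeal K X₀ G) (decompositionIndex G) := fun _ _ _ hZ h =>
  eq_of_componentIdeal_le (mem_decompositionIndex_iff.mp hZ) h.le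

theorem isMinimalPrimaryDecomposition_edgeIdeal [Nontrivial X₀] [Fintype X]
    (G : SimpleGraph X) :
    Submodule.IsMinimalPrimaryDecomposition (edgeIdeal K X₀ G)
      ((decompositionIndex G).image (componentIdeal K X₀ G)) where
  inf_eq := by
    rw [Finset.inf_image, Function.id_comp, Finset.inf_eq_iInf, edgeIdeal_eq_iInf_decompositionIndex]
  primary J hJ := by
    obtain ⟨Y, -, rfl⟩ := Finset.mem_image.mp hJ
    exact (isPrime_componentIdeal K X₀ G Y).isPrimary
  distinct J hJ J' hJ' hne := by
    obtain ⟨Y, -, rfl⟩ := Finset.mem_image.mp hJ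
    obtain ⟨Z, -, rfl⟩ := Finset.mem_image.mp hJ'
    have h : ∀ Y, ((componentIdeal K X₀ G Y).colon Set.univ).radical = componentIdeal K X₀ G Y :=
      fun Y => by
        rw [Submodule.colon_univ, (isPrime_componentIdeal K X₀ G Y).radical]
    simpa only [Function.onFun, h] using hne
  minimal J hJ hle := by
    obtain ⟨Z, hZ, rfl⟩ := Finset.mem_image.mp hJ
    obtain ⟨I, hI, hIle⟩ := (Ideal.IsPrime.inf_le' (isPrime_componentIdeal K X₀ G Z)).mp hle
    obtain ⟨hne, hI⟩ := Finset.mem_erase.mp hI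
    obtain ⟨Y, -, rfl⟩ := Finset.mem_image.mp hI
    exact hne (congrArg _ (eq_of_componentIdeal_le (mem_decompositionIndex_iff.mp hZ) hIle))

theorem minimalPrimes_edgeIdeal [Nontrivial X₀] [Fintype X] :
    (edgeIdeal K X₀ G).minimalPrimes = componentIdeal K X₀ G '' (decompositionIndex G) := by
  classical
  have hle : ∀ p : Ideal (MvPolynomial (X₀ × X) K), p.IsPrime → edgeIdeal K X₀ G ≤ p →
      ∃ Y ∈ decompositionIndex G, componentIdeal K X₀ G Y ≤ p := fun p hp h => by
    rw [edgeIdeal_eq_iInf_decompositionIndex, ← Finset.inf_eq_iInf] at h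
    exact (Ideal.IsPrime.inf_le' hp).mp h
  ext p
  constructor
  · intro hp
    obtain ⟨Y, hY, hYp⟩ := hle p hp.1.1 hp.1.2
    exact ⟨Y, hY, le_antisymm hYp
      (hp.2 ⟨isPrime_componentIdeal K X₀ G Y, edgeIdeal_le_componentIdeal⟩ hYp)⟩
  · rintro ⟨Z, hZ, rfl⟩
    refine ⟨⟨isPrime_componentIdeal K X₀ G Z, edgeIdeal_le_componentIdeal⟩, fun q hq hqZ => ?_⟩
    obtain ⟨Y, hY, hYq⟩ := hle q hq.1 hq.2
    rw [← eq_of_componentIdeal_le (mem_decompositionIndex_iff.mp hZ) (hYq.trans hqZ)]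
    exact hYq

end Decomposition

/-! ### Extension of the base field, checked on generators. -/

section BaseChange

open MvPolynomial

variable {K : Type u} [Field K] {X₀ X : Type v} {L : Type w} [Field L] (φ : K →+* L)

theorem map_minorPoly (i j : X₀) (x y : X) :
    MvPolynomial.map φ (minorPoly K i j x y) = minorPoly L i j x y := by
  simp [minorPoly]

theorem map_edgeIdeal (G : SimpleGraph X) :
    (edgeIdeal K X₀ G).map (MvPolynomial.map φ) = edgeIdeal L X₀ G := by
  rw [edgeIdeal, Ideal.map_span, edgeIdeal]
  congr 1
  ext f
  constructor
  · rintro ⟨_, ⟨i, j, x, y, h, rfl⟩, rfl⟩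
    exact ⟨i, j, x, y, h, map_minorPoly φ i j x y⟩
  · rintro ⟨i, j, x, y, h, rfl⟩
    exact ⟨_, ⟨i, j, x, y, h, rfl⟩, map_minorPoly φ i j x y⟩

theorem map_componentIdeal (G : SimpleGraph X) (Y : Set X) :
    (componentIdeal K X₀ G Y).map (MvPolynomial.map φ) = componentIdeal L X₀ G Y := by
  rw [componentIdeal, Ideal.map_span, componentIdeal]
  congr 1
  ext f
  constructor
  · rintro ⟨_, ⟨i, x, h, rfl⟩ | ⟨i, j, x, y, h, rfl⟩, rfl⟩
    · exact Or.inl ⟨i, x, h, map_X φ _⟩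
    · exact Or.inr ⟨i, j, x, y, h, map_minorPoly φ i j x y⟩
  · rintro (⟨i, x, h, rfl⟩ | ⟨i, j, x, y, h, rfl⟩)
    · exact ⟨_, Or.inl ⟨i, x, h, rfl⟩, map_X φ _⟩
    · exact ⟨_, Or.inr ⟨i, j, x, y, h, rfl⟩, map_minorPoly φ i j x y⟩

end BaseChange

/-! ### Birationality from a common principal open subset. -/

section Rationality

open AlgebraicGeometry CategoryTheory

theorem isDominant_SpecMap_of_injective {R S : Type u} [CommRing R] [CommRing S] {f : R →+* S}
    (hf : Function.Injective f) : IsDominant (Spec.map (CommRingCat.ofHom f)) := by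
  refine ⟨?_⟩
  have : DenseRange (PrimeSpectrum.comap f) :=
    (PrimeSpectrum.denseRange_comap_iff_ker_le_nilRadical f).mpr (by
      rw [(RingHom.injective_iff_ker_eq_bot f).mp hf]; exact bot_le)
  exact this

/-- An affine scheme sharing a principal open dense subset with the spectrum of a polynomial ring
is rational. -/
theorem isRationalOver_of_isLocalization_away {K A S n : Type u} [CommRing K] [CommRing A]
    [CommRing S] [Algebra K A] [Algebra (MvPolynomial n K) S] [Algebra A S] (a : A)
    (b : MvPolynomial n K) [IsLocalization.Away a S] [IsLocalization.Away b S]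
    (ha : Function.Injective (algebraMap A S))
    (hb : Function.Injective (algebraMap (MvPolynomial n K) S))
    (h : (algebraMap A S).comp (algebraMap K A) =
      (algebraMap (MvPolynomial n K) S).comp MvPolynomial.C) :
    Scheme.IsRationalOver (Spec.map (CommRingCat.ofHom (algebraMap K A))) := by
  have h₁ : IsOpenImmersion (Spec.map (CommRingCat.ofHom (algebraMap A S))) :=
    IsOpenImmersion.of_isLocalization a
  have h₂ : IsOpenImmersion (Spec.map (CommRingCat.ofHom (algebraMap (MvPolynomial n K) S))) :=
    IsOpenImmersion.of_isLocalization b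
  have h₃ := isDominant_SpecMap_of_injective ha
  have h₄ := isDominant_SpecMap_of_injective hb
  let sS := Spec.map (CommRingCat.ofHom ((algebraMap A S).comp (algebraMap K A)))
  have b₁ : Scheme.BirationalOver sS (Spec.map (CommRingCat.ofHom (algebraMap K A))) :=
    Scheme.Hom.birationalOver (Spec.map (CommRingCat.ofHom (algebraMap A S))) _ _ (by
      rw [← Spec.map_comp]; rfl)
  have b₂ : Scheme.BirationalOver sS
      (Spec.map (CommRingCat.ofHom (MvPolynomial.C : K →+* MvPolynomial n K))) :=
    Scheme.Hom.birationalOver (Spec.map (CommRingCat.ofHom (algebraMap (MvPolynomial n K) S))) _ _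
      (by rw [← Spec.map_comp, ← CommRingCat.ofHom_comp, ← h])
  have b₃ : Scheme.BirationalOver
      (Spec.map (CommRingCat.ofHom (MvPolynomial.C : K →+* MvPolynomial n K)))
      (𝔸(n; Spec (.of K)) ↘ Spec (.of K)) :=
    Scheme.Hom.birationalOver (AffineSpace.SpecIso n (.of K)).inv _ _
      (AffineSpace.SpecIso_inv_over (.of K))
  exact ⟨n, (b₁.symm.trans b₂).trans b₃⟩

end Rationality

/-! ### A rational chart for the variety of `I_{G,Y}`. -/

section Rationality

open AlgebraicGeometry MvPolynomial

/-- Up to powers of `α b`, every element of `A` comes from the polynomial ring. As `A` is a domain,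
`β` is injective and makes `S` the localization of `A` at `α b` as well. -/
theorem isRationalOver_of_leftInverse {K A S n : Type u} [Field K] [CommRing A] [IsDomain A]
    [Algebra K A] [CommRing S] [Algebra K S] [Algebra (MvPolynomial n K) S]
    [IsScalarTower K (MvPolynomial n K) S]
    {b : MvPolynomial n K} [IsLocalization.Away b S] (hb : b ≠ 0) (α : MvPolynomial n K →ₐ[K] A)
    (β : A →ₐ[K] S) (hβα : ∀ g, β (α g) = algebraMap _ _ g)
    (h : ∀ x, ∃ (k : ℕ) (g : MvPolynomial n K), α b ^ k * x = α g) :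
    Scheme.IsRationalOver (Spec.map (CommRingCat.ofHom (algebraMap K A))) := by
  have hinj : Function.Injective (algebraMap (MvPolynomial n K) S) :=
    IsLocalization.injective _ (powers_le_nonZeroDivisors_of_noZeroDivisors hb)
  have hα : α b ≠ 0 := fun h0 => hb (hinj (by rw [← hβα, h0, map_zero, map_zero]))
  have hβ : Function.Injective β := by
    rw [injective_iff_map_eq_zero]
    intro x hx
    obtain ⟨k, g, hg⟩ := h x
    have hg0 : g = 0 := hinj (by rw [← hβα, ← hg, map_mul, hx, mul_zero, map_zero])
    rw [hg0, map_zero] at hg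
    exact (mul_eq_zero.mp hg).resolve_left (pow_ne_zero _ hα)
  let : Algebra A S := β.toRingHom.toAlgebra
  have : IsLocalization.Away (α b) S := by
    refine IsLocalization.Away.mk _ ?_ (fun s => ?_) fun x y hxy => ⟨0, by rw [hβ hxy]⟩
    · change IsUnit (β (α b))
      rw [hβα]
      exact IsLocalization.Away.algebraMap_isUnit b
    · refine ⟨(IsLocalization.Away.sec b s).2, α (IsLocalization.Away.sec b s).1, ?_⟩
      change s * β (α b) ^ _ = β (α _)
      rw [hβα, hβα, ← map_pow]
      exact IsLocalization.Away.sec_spec b s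
  refine isRationalOver_of_isLocalization_away (α b) b hβ hinj (RingHom.ext fun c => ?_)
  change β (algebraMap K A c) = algebraMap _ _ (algebraMap K (MvPolynomial n K) c)
  rw [← hβα, AlgHom.commutes, AlgHom.commutes, AlgHom.commutes]

theorem exists_representative {X : Type v} (G : SimpleGraph X) (Y : Set X) :
    ∃ r : X → X, (∀ x ∈ Y, ConnectedWithin G Y x (r x)) ∧
      ∀ x y, ConnectedWithin G Y x y → r x = r y := by
  -- The chosen element depends only on the class as a set, hence is constant on components.
  refine ⟨fun x => @Classical.epsilon X ⟨x⟩ (· ∈ componentClass G Y x), fun x hx => ?_,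
    fun x y h => ?_⟩
  · exact @Classical.epsilon_spec X (· ∈ componentClass G Y x) ⟨x, .refl hx⟩
  · simp only [componentClass_eq_of_connectedWithin h]

/-- The entries of the row `o`, together with the columns of a set of representatives `r x` of the
components of `G_Y`. -/
def RepresentativeEntry {X₀ X : Type u} (Y : Set X) (o : X₀) (r : X → X) : Type u :=
  {p : X₀ × X // p.2 ∈ Y ∧ (p.1 = o ∨ r p.2 = p.2)}

/-- On the open set where the entries of one row in a set of representatives of the components are
invertible, the remaining entries of the matrix are rational functions of this row and the
representative columns. -/
theorem exists_algHom_of_representatives {K X₀ X : Type u} [Field K] (G : SimpleGraph X)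
    (Y : Set X) {o : X₀} {r : X → X} (hr' : ∀ x y, ConnectedWithin G Y x y → r x = r y)
    {S : Type u} [CommRing S] [Algebra K S] (t : X₀ × X → S)
    (hunit : ∀ x ∈ Y, IsUnit (t (o, r x))) :
    ∃ β : (MvPolynomial (X₀ × X) K ⧸ componentIdeal K X₀ G Y) →ₐ[K] S,
      ∀ p : RepresentativeEntry Y o r,
        β (Ideal.Quotient.mk _ (MvPolynomial.X p.1)) = t p.1 := by
  classical
  -- A vanishing minor forces `p_{ix} = p_{ox} p_{i,r(x)} / p_{o,r(x)}`.
  let q (p : X₀ × X) : S :=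
    if p.2 ∈ Y then t (o, p.2) * t (p.1, r p.2) * Ring.inverse (t (o, r p.2)) else 0
  have hq : ∀ i, ∀ x ∈ Y, q (i, x) = t (o, x) * t (i, r x) * Ring.inverse (t (o, r x)) :=
    fun i x hx => if_pos hx
  have hI : ∀ f ∈ componentIdeal K X₀ G Y, aeval (R := K) q f = 0 := by
    suffices h : componentIdeal K X₀ G Y ≤ RingHom.ker (aeval (R := K) q) from fun f hf => h hf
    refine Ideal.span_le.mpr ?_
    rintro _ (⟨i, x, hx, rfl⟩ | ⟨i, j, x, y, h, rfl⟩)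
    · exact (aeval_X q _).trans (if_neg hx)
    · simp only [SetLike.mem_coe, RingHom.mem_ker, minorPoly, map_sub, map_mul, aeval_X,
        hq _ _ h.left_mem, hq _ _ h.right_mem, hr' x y h]
      ring
  refine ⟨Ideal.Quotient.liftₐ _ (aeval q) hI, fun p => ?_⟩
  change aeval q (MvPolynomial.X p.1) = _
  obtain ⟨⟨i, x⟩, hx, hp⟩ := p
  change aeval q (MvPolynomial.X (i, x)) = t (i, x)
  rw [aeval_X, hq i x hx]
  rcases hp with rfl | hp
  · rw [mul_assoc, Ring.mul_inverse_cancel _ (hunit x hx), mul_one]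
  · have := hunit x hx
    change r x = x at hp
    rw [hp] at this ⊢
    rw [mul_right_comm, Ring.mul_inverse_cancel _ this, one_mul]

/-- The relation `p_{o,r(x)} p_{ix} = p_{i,r(x)} p_{ox}` holds in the quotient and `p_{o,r(x)}`
divides `b`, so each additional unknown costs at most one more power of `b`. -/
theorem exists_pow_mul_eq_of_representatives {K X₀ X : Type u} [Field K] {G : SimpleGraph X}
    {Y : Set X} {o : X₀} {r : X → X} (hr : ∀ x ∈ Y, ConnectedWithin G Y x (r x))
    (e : ∀ x ∈ Y, RepresentativeEntry Y o r) (he : ∀ x hx, (e x hx).1 = (o, x))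
    (d : X₀ → ∀ x ∈ Y, RepresentativeEntry Y o r) (hd : ∀ i x hx, (d i x hx).1 = (i, r x))
    {b : MvPolynomial (RepresentativeEntry Y o r) K}
    (hdvd : ∀ x hx, MvPolynomial.X (d o x hx) ∣ b)
    (α : MvPolynomial (RepresentativeEntry Y o r) K →ₐ[K]
      MvPolynomial (X₀ × X) K ⧸ componentIdeal K X₀ G Y)
    (hα : ∀ p, α (MvPolynomial.X p) = Ideal.Quotient.mk _ (MvPolynomial.X p.1))
    (x : MvPolynomial (X₀ × X) K ⧸ componentIdeal K X₀ G Y) :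
    ∃ (k : ℕ) (g : MvPolynomial (RepresentativeEntry Y o r) K), α b ^ k * x = α g := by
  obtain ⟨f, rfl⟩ := Ideal.Quotient.mk_surjective x
  induction f using MvPolynomial.induction_on with
  | C c => exact ⟨0, MvPolynomial.C c, by rw [pow_zero, one_mul]; exact (α.commutes c).symm⟩
  | add f g hf hg =>
    obtain ⟨k, f', hf⟩ := hf
    obtain ⟨l, g', hg⟩ := hg
    refine ⟨k + l, b ^ l * f' + b ^ k * g', ?_⟩
    rw [map_add, map_add, map_mul, map_mul, map_pow, map_pow, ← hf, ← hg]
    ring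
  | mul_X f p hf =>
    obtain ⟨k, f', hf⟩ := hf
    obtain ⟨i, x⟩ := p
    by_cases hx : x ∈ Y
    · obtain ⟨b', hb'⟩ := hdvd x hx
      refine ⟨k + 1, f' * (MvPolynomial.X (d i x hx) * MvPolynomial.X (e x hx) * b'), ?_⟩
      have hminor : α (MvPolynomial.X (d o x hx)) * Ideal.Quotient.mk _ (MvPolynomial.X (i, x)) =
          α (MvPolynomial.X (d i x hx)) * α (MvPolynomial.X (e x hx)) := by
        rw [hα, hα, hα, hd, hd, he, ← map_mul, ← map_mul]
        refine Ideal.Quotient.eq.mpr ?_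
        have := minorPoly_mem_componentIdeal (K := K) (hr x hx).symm o i
        rw [minorPoly] at this
        rwa [mul_comm (MvPolynomial.X (i, r x))]
      have hbα : α b = α (MvPolynomial.X (d o x hx)) * α b' := by rw [hb', map_mul]
      rw [map_mul, map_mul, map_mul, map_mul, ← hf, ← hminor, pow_succ]
      conv_lhs => rw [mul_assoc, hbα]
      conv_rhs => rw [hbα]
      ring
    · refine ⟨0, 0, ?_⟩
      rw [map_mul, Ideal.Quotient.eq_zero_iff_mem.mpr (X_mem_componentIdeal hx i), mul_zero,
        mul_zero, map_zero]

theorem exists_ne_zero_forall_X_dvd (K : Type u) [Field K] {σ : Type v} {ι : Type w} [Finite ι]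
    (f : ι → σ) : ∃ b : MvPolynomial σ K, b ≠ 0 ∧ ∀ i, MvPolynomial.X (f i) ∣ b := by
  have := Fintype.ofFinite ι
  exact ⟨∏ i, MvPolynomial.X (f i), Finset.prod_ne_zero_iff.mpr fun _ _ => X_ne_zero _,
    fun i => Finset.dvd_prod_of_mem _ (Finset.mem_univ i)⟩

/-- The variety of `I_{G,Y}` is rational. -/
theorem isRationalZeroScheme_componentIdeal {K X₀ X : Type u} [Field K] [Nonempty X₀] [Finite X]
    (G : SimpleGraph X) (Y : Set X) : IsRationalZeroScheme (componentIdeal K X₀ G Y) := by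
  classical
  obtain ⟨o⟩ := ‹Nonempty X₀›
  obtain ⟨r, hr, hr'⟩ := exists_representative G Y
  have hrY : ∀ x ∈ Y, r x ∈ Y := fun x hx => (hr x hx).right_mem
  have hrr : ∀ x ∈ Y, r (r x) = r x := fun x hx => (hr' _ _ (hr x hx)).symm
  let e (x : X) (hx : x ∈ Y) : RepresentativeEntry Y o r := ⟨(o, x), hx, Or.inl rfl⟩
  let d (i : X₀) (x : X) (hx : x ∈ Y) : RepresentativeEntry Y o r :=
    ⟨(i, r x), hrY x hx, Or.inr (hrr x hx)⟩
  obtain ⟨b, hb, hdvd⟩ := exists_ne_zero_forall_X_dvd K fun x : Y => d o x x.2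
  -- The value `0` off the chart is immaterial: the formula for `β` reads only chart entries.
  obtain ⟨t, ht⟩ : ∃ t : X₀ × X → Localization.Away b, ∀ p : RepresentativeEntry Y o r,
      t p.1 = algebraMap (MvPolynomial (RepresentativeEntry Y o r) K) _ (MvPolynomial.X p) :=
    ⟨fun p => if h : p.2 ∈ Y ∧ (p.1 = o ∨ r p.2 = p.2) then
      algebraMap (MvPolynomial (RepresentativeEntry Y o r) K) _ (MvPolynomial.X ⟨p, h⟩) else 0, fun p => dif_pos p.2⟩
  have hunit : ∀ x ∈ Y, IsUnit (t (o, r x)) := fun x hx => by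
    rw [show t (o, r x) = _ from ht (d o x hx)]
    exact isUnit_of_dvd_unit (map_dvd _ (hdvd ⟨x, hx⟩)) (IsLocalization.Away.algebraMap_isUnit b)
  obtain ⟨β, hβ⟩ := exists_algHom_of_representatives (K := K) G Y hr' t hunit
  obtain ⟨α, hα⟩ : ∃ α : MvPolynomial (RepresentativeEntry Y o r) K →ₐ[K]
      MvPolynomial (X₀ × X) K ⧸ componentIdeal K X₀ G Y,
      ∀ p, α (MvPolynomial.X p) = Ideal.Quotient.mk _ (MvPolynomial.X p.1) :=
    ⟨aeval fun p => Ideal.Quotient.mk _ (MvPolynomial.X p.1), fun p => aeval_X _ p⟩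
  have := isPrime_componentIdeal K X₀ G Y
  refine isRationalOver_of_leftInverse hb α β (fun g => ?_)
    (exists_pow_mul_eq_of_representatives hr e (fun _ _ => rfl) d (fun _ _ _ => rfl)
      (fun x hx => hdvd ⟨x, hx⟩) α hα)
  have h : β.comp α = IsScalarTower.toAlgHom K _ (Localization.Away b) :=
    MvPolynomial.algHom_ext fun p => by
      rw [AlgHom.comp_apply, hα, hβ, ht, IsScalarTower.toAlgHom_apply]
  exact DFunLike.congr_fun h g

end Rationality

open Classical in
theorem theorem3p3 {K : Type u} [Field K] {X₀ X : Type u} [Fintype X₀] [Fintype X]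
    (hX₀ : 1 < Fintype.card X₀) (G : SimpleGraph X) :
    -- the two descriptions of the index sets `Y` agree
    (∀ Y : Set X, Y ∈ decompositionIndex G ↔ JoinsOutside G Y) ∧
    -- `I_G` is the intersection of the ideals `I_{G,Y}`
    edgeIdeal K X₀ G = ⨅ Y ∈ decompositionIndex G, componentIdeal K X₀ G Y ∧
    -- which are prime, and whose varieties are rational
    (∀ Y : Set X, (componentIdeal K X₀ G Y).IsPrime ∧
      IsRationalZeroScheme (componentIdeal K X₀ G Y)) ∧
    -- distinct index sets give distinct ideals, the decomposition is a minimal primary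
    -- decomposition, and its components are exactly the minimal primes
    Set.InjOn (componentIdeal K X₀ G) (decompositionIndex G) ∧
    Submodule.IsMinimalPrimaryDecomposition (edgeIdeal K X₀ G)
      ((decompositionIndex G).image (componentIdeal K X₀ G)) ∧
    (edgeIdeal K X₀ G).minimalPrimes = componentIdeal K X₀ G '' (decompositionIndex G) ∧
    -- independence of the base field
    (∀ (L : Type v) [Field L] [Algebra K L],
      (edgeIdeal K X₀ G).map (MvPolynomial.map (algebraMap K L)) = edgeIdeal L X₀ G ∧
      (∀ Y : Set X,
        (componentIdeal K X₀ G Y).map (MvPolynomial.map (algebraMap K L)) =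
          componentIdeal L X₀ G Y ∧
        (componentIdeal L X₀ G Y).IsPrime) ∧
      Submodule.IsMinimalPrimaryDecomposition (edgeIdeal L X₀ G)
        ((decompositionIndex G).image (componentIdeal L X₀ G))) := by
  have : Nontrivial X₀ := Fintype.one_lt_card_iff_nontrivial.mp hX₀
  refine ⟨fun Y => mem_decompositionIndex_iff, edgeIdeal_eq_iInf_decompositionIndex,
    fun Y => ⟨isPrime_componentIdeal K X₀ G Y, isRationalZeroScheme_componentIdeal G Y⟩,
    injOn_componentIdeal, isMinimalPrimaryDecomposition_edgeIdeal G, minimalPrimes_edgeIdeal,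
    fun L _ _ => ⟨map_edgeIdeal _ G,
      fun Y => ⟨map_componentIdeal _ G Y, isPrime_componentIdeal L X₀ G Y⟩,
      isMinimalPrimaryDecomposition_edgeIdeal G⟩⟩
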